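/- Let $k$ be a field, $R=k[x,y,z]$, and let $\phi$ be an $n\times(n-1)$ matrix whose entries are linear forms of $R$ (zero allowed). For $t\ge 1$ let $I_t(\phi)\subset R$ be the ideal generated by the $t\times t$ minors of $\phi$, and set $I:=I_{n-1}(\phi)$. Assume that $\operatorname{ht} I_1(\phi)=3$ and $\operatorname{ht} I=2$. Let $u=u(\phi)$ be the chaos invariant of $\phi$, that is, the unique integer $1\le u\le n-2$ such that $\operatorname{ht} I_t(\phi)=3$ for $1\le t\le u$ and $\operatorname{ht} I_t(\phi)=2$ for $u+1\le t\le n-1$. For an associated prime $p$ of $R/I$, let $u_p$ be the chaos invariant of $\phi$ at $p$, that is, the unique integer $1\le u_p\le n-2$ such that $p$ is a minimal prime of $I_{u_p+1}(\phi)$ but not of $I_{u_p}(\phi)$. Suppose that $n\ge 2(u+1)$. Then: (a) there is a prime ideal $q$ of $R$ such that, for every $t$ with $u+1\le t\le n-(u+1)$, $q$ is the unique minimal prime of $I_t(\phi)$; (b) for every associated prime $p\ne q$ of $R/I$ one has $u_p\ge n-(u+1)$ and $\mu(I_p)\le u+1$, where $\mu(I_p)$ is the minimal number of generators of the ideal $I_p=IR_p$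 of the local ring $R_p$. -/

import Mathlib

namespace Chaos

/-- The ideal `I_t(A)` generated by the `t × t` minors of the matrix `A`, that is, by the
determinants of the submatrices given by `t` distinct rows and `t` distinct columns
(reordering rows or columns only changes a sign). -/
def minorsIdeal {R : Type*} [CommRing R] {m n : Type*} (t : ℕ) (A : Matrix m n R) : Ideal R :=
  Ideal.span {d : R | ∃ (r : Fin t ↪ m) (c : Fin t ↪ n), d = (A.submatrix r c).det}

/-- `v` has the defining property of the chaos invariant of the `n × (n-1)` matrix `A`:
`1 ≤ v ≤ n - 2`, `ht I_t(A) = 3` for `1 ≤ t ≤ v`, and `ht I_t(A) = 2` for `v + 1 ≤ t ≤ n - 1`. -/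
def IsChaosInvariant {R : Type*} [CommRing R] {n : ℕ}
    (A : Matrix (Fin n) (Fin (n - 1)) R) (v : ℕ) : Prop :=
  1 ≤ v ∧ v + 2 ≤ n ∧
    (∀ t, 1 ≤ t → t ≤ v → (minorsIdeal t A).height = 3) ∧
    (∀ t, v + 1 ≤ t → t ≤ n - 1 → (minorsIdeal t A).height = 2)

/-- The chaos invariant `u(A)`: the unique `v` with `IsChaosInvariant A v`
(see `existsUnique_isChaosInvariant`; the value is `0` if there is none). -/
noncomputable def chaosInvariant {R : Type*} [CommRing R] {n : ℕ}
    (A : Matrix (Fin n) (Fin (n - 1)) R) : ℕ :=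
  sInf {v : ℕ | IsChaosInvariant A v}

/-- `v` has the defining property of the chaos invariant of the `n × (n-1)` matrix `A` at `p`:
`1 ≤ v ≤ n - 2` and `p` is a minimal prime of `I_{v+1}(A)` but not of `I_v(A)`. -/
def IsChaosInvariantAt {R : Type*} [CommRing R] {n : ℕ}
    (A : Matrix (Fin n) (Fin (n - 1)) R) (p : Ideal R) (v : ℕ) : Prop :=
  1 ≤ v ∧ v + 2 ≤ n ∧
    p ∈ (minorsIdeal (v + 1) A).minimalPrimes ∧ p ∉ (minorsIdeal v A).minimalPrimes

/-- The chaos invariant `u_p` of `A` at `p`: the unique `v` with `IsChaosInvariantAt A p v`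
(at most one exists, see `IsChaosInvariantAt.eq`; the value is `0`, which is not attained
otherwise, if there is none). -/
noncomputable def chaosInvariantAt {R : Type*} [CommRing R] {n : ℕ}
    (A : Matrix (Fin n) (Fin (n - 1)) R) (p : Ideal R) : ℕ :=
  sInf {v : ℕ | IsChaosInvariantAt A p v}

theorem minorsIdeal_succ_le {R : Type*} [CommRing R] {m n : Type*} (t : ℕ) (A : Matrix m n R) :
    minorsIdeal (t + 1) A ≤ minorsIdeal t A := by
  refine Ideal.span_le.2 ?_
  rintro _ ⟨r, c, rfl⟩
  rw [Matrix.det_succ_row_zero]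
  refine Ideal.sum_mem _ fun j _ => Ideal.mul_mem_left _ _ (Ideal.subset_span ?_)
  exact ⟨(Fin.succEmb t).trans r, (Fin.succAboveEmb j).trans c, rfl⟩

theorem minorsIdeal_antitone {R : Type*} [CommRing R] {m n : Type*} (A : Matrix m n R) :
    Antitone fun t => minorsIdeal t A :=
  antitone_nat_of_succ_le fun t => minorsIdeal_succ_le t A

theorem existsUnique_isChaosInvariant {R : Type*} [CommRing R] {n : ℕ}
    (A : Matrix (Fin n) (Fin (n - 1)) R) (h1 : (minorsIdeal 1 A).height = 3)
    (h2 : (minorsIdeal (n - 1) A).height = 2) :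
    ∃! v, IsChaosInvariant A v := by
  classical
  have anti : ∀ {s t : ℕ}, s ≤ t → (minorsIdeal t A).height ≤ (minorsIdeal s A).height :=
    fun h => Ideal.height_mono (minorsIdeal_antitone A h)
  have hex : ∃ t, (minorsIdeal (t + 1) A).height ≤ 2 := ⟨n - 1, h2 ▸ anti (Nat.le_succ _)⟩
  have h0 : ¬ (n - 1 ≤ 1) := fun h => by
    have := anti h
    rw [h1, h2] at this
    exact absurd this (by decide)
  have key : ∀ t, 1 ≤ t → t ≤ n - 1 →
      (minorsIdeal t A).height = 2 ∨ (minorsIdeal t A).height = 3 := fun t ht ht' => by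
    have a := anti ht
    have b := anti ht'
    rw [h1] at a
    rw [h2] at b
    obtain ⟨x, hx⟩ := ENat.ne_top_iff_exists.1 (ne_top_of_le_ne_top (by decide) a)
    rw [← hx] at a b ⊢
    norm_cast at a b ⊢
    omega
  have hlt : ∀ m < Nat.find hex, ¬ (minorsIdeal (m + 1) A).height ≤ 2 :=
    fun m hm => Nat.find_min hex hm
  have hfn : Nat.find hex ≤ n - 2 := Nat.find_min' hex (by
    rw [show n - 2 + 1 = n - 1 by omega, h2])
  have hf1 : 1 ≤ Nat.find hex := by
    by_contra h
    have := Nat.find_spec hex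
    rw [show Nat.find hex = 0 by omega, zero_add, h1] at this
    exact absurd this (by decide)
  refine ⟨Nat.find hex, ⟨hf1, by omega, fun t ht ht' => ?_, fun t ht ht' => ?_⟩, ?_⟩
  · refine (key t ht (by omega)).resolve_left fun h => hlt (t - 1) (by omega) ?_
    rw [Nat.sub_add_cancel ht, h]
  · refine (key t (by omega) ht').resolve_right fun h => ?_
    have := (anti ht).trans (Nat.find_spec hex)
    rw [h] at this
    exact absurd this (by decide)
  · rintro v ⟨hv1, hvn, hv3, hv2⟩
    refine le_antisymm ?_ (Nat.find_min' hex (hv2 (v + 1) le_rfl (by omega)).le)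
    by_contra! h
    have := Nat.find_spec hex
    rw [hv3 _ (by omega) h] at this
    exact absurd this (by decide)

theorem IsChaosInvariantAt.eq {R : Type*} [CommRing R] {n : ℕ}
    {A : Matrix (Fin n) (Fin (n - 1)) R} {p : Ideal R} {v w : ℕ}
    (hv : IsChaosInvariantAt A p v) (hw : IsChaosInvariantAt A p w) : v = w := by
  have aux : ∀ {v w : ℕ}, IsChaosInvariantAt A p v → IsChaosInvariantAt A p w → ¬ v < w := by
    rintro v w ⟨-, -, hv, -⟩ ⟨-, -, hw, hw'⟩ hlt
    refine hw' ⟨⟨hv.1.1, (minorsIdeal_antitone A hlt).trans hv.1.2⟩, fun J hJ hJp => ?_⟩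
    exact hw.2 ⟨hJ.1, (minorsIdeal_succ_le w A).trans hJ.2⟩ hJp
  exact le_antisymm (not_lt.1 (aux hw hv)) (not_lt.1 (aux hv hw))

end Chaos

/-! Part (a) is a join argument. If `φ` has rank at most `r₁` modulo a prime `p₁` and at most `r₂`
modulo `p₂`, then, its entries being linear, its value at a generic point of the join of the two
loci is a combination of its two values, hence has rank at most `r₁ + r₂`. The prime `J` of the join
lies in `p₁ ∩ p₂` and contains `I_{r₁+r₂+1}(φ)` (`exists_prime_le_of_minorsIdeal_le`). Take for `q`
a minimal prime of `I_{n-1}` containing `I_{u+1}`, which exists because both ideals have height 2.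
Joining `q` with a prime `p` containing `I_{n-1-u}` gives ranks `u` and `n-2-u`, so `J` contains
`I_{n-1}`; minimality forces `J = q`, whence `q ≤ p`.

For (b), Hilbert–Burch makes `R/I` unmixed (`mem_minimalPrimes_of_mem_associatedPrimes`), so an
associated prime `p ≠ q` is minimal over `I` and cannot contain `q`. Thus `I_{n-1-u}` is not
contained in `p`: this bounds `u_p` from below, and a minor of size `n-1-u` that is a unit in `R_p`
makes all but `u + 1` generators redundant. -/

namespace Chaos

open Matrix

/-! ### Minors and rank over a field -/

section Rank

theorem minorsIdeal_map_eq_bot {R S : Type*} [CommRing R] [CommRing S] {m n : Type*} {t : ℕ}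
    {A : Matrix m n R} (f : R →+* S) (h : minorsIdeal t A ≤ RingHom.ker f) :
    minorsIdeal t (A.map f) = ⊥ := by
  rw [minorsIdeal, Ideal.span_eq_bot]
  rintro _ ⟨r, c, rfl⟩
  rw [submatrix_map, ← RingHom.mapMatrix_apply, ← RingHom.map_det]
  exact h (Ideal.subset_span ⟨r, c, rfl⟩)

theorem exists_linearIndependent_rows {K : Type*} [Field K] {m n : Type*} [Finite m] [Fintype n]
    (A : Matrix m n K) : ∃ r : Fin A.rank → m, LinearIndependent K (A.submatrix r id).row := by
  rw [rank_eq_finrank_span_row]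
  obtain ⟨f, hf, -, hli⟩ := Submodule.exists_fun_fin_finrank_span_eq K (Set.range A.row)
  choose r hr using hf
  exact ⟨r, (funext hr : (A.submatrix r id).row = f) ▸ hli⟩

theorem minorsIdeal_rank_ne_bot {K : Type*} [Field K] {m n : Type*} [Fintype m] [Fintype n]
    (A : Matrix m n K) : minorsIdeal A.rank A ≠ ⊥ := by
  obtain ⟨r, hr⟩ := exists_linearIndependent_rows A
  have hrank : (A.submatrix r id)ᵀ.rank = A.rank := by
    rw [rank_transpose, hr.rank_matrix, Fintype.card_fin]
  obtain ⟨c, hc⟩ := hrank ▸ exists_linearIndependent_rows (A.submatrix r id)ᵀ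
  have hdet : (A.submatrix r c).det ≠ 0 := by
    rw [← det_transpose]
    exact (linearIndependent_rows_iff_isUnit.1 hc).map detMonoidHom |>.ne_zero
  refine fun h => hdet ((Ideal.span_eq_bot.1 h) _ ⟨⟨r, ?_⟩, ⟨c, ?_⟩, rfl⟩)
  · exact fun a b hab => hr.injective (funext fun j => congrArg (A · j) hab)
  · exact fun a b hab => hc.injective (funext fun j => congrArg (A (r j)) hab)

theorem rank_le_of_minorsIdeal_eq_bot {K : Type*} [Field K] {m n : Type*} [Fintype m] [Fintype n]
    {A : Matrix m n K} {r : ℕ} (h : minorsIdeal (r + 1) A = ⊥) : A.rank ≤ r := by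
  by_contra! hr
  exact minorsIdeal_rank_ne_bot A (le_bot_iff.1 ((minorsIdeal_antitone A hr).trans h.le))

theorem minorsIdeal_eq_bot_of_rank_le {K : Type*} [Field K] {m n : Type*} [Fintype m] [Fintype n]
    {A : Matrix m n K} {r : ℕ} (h : A.rank ≤ r) : minorsIdeal (r + 1) A = ⊥ := by
  rw [minorsIdeal, Ideal.span_eq_bot]
  rintro _ ⟨r', c, rfl⟩
  by_contra hd
  have h1 := rank_of_det_ne_zero hd
  have h2 := rank_submatrix_le A r' c
  simp at h1
  omega

theorem rank_add_le {K : Type*} [Field K] {m n : Type*} [Fintype m] [Fintype n]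
    (A B : Matrix m n K) : (A + B).rank ≤ A.rank + B.rank := by
  have h := LinearMap.rank_add_le A.mulVecLin B.mulVecLin
  rw [← mulVecLin_add] at h
  simp only [LinearMap.rank, ← Module.finrank_eq_rank] at h
  exact_mod_cast h

theorem rank_smul_le {K : Type*} [Field K] {m n : Type*} [Fintype m] [Fintype n]
    (a : K) (A : Matrix m n K) : (a • A).rank ≤ A.rank := by
  classical
  simpa using rank_mul_le_left A (a • (1 : Matrix n n K))

end Rank

/-! ### The join of two rank loci of a linear matrix -/

section Join

open MvPolynomial TensorProduct

/-- The tensor product of the two residue fields over `k` is nonzero, so it has a residue field;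
both factors embed in it, which keeps the kernels equal to `p₁` and `p₂`. -/
theorem exists_common_field.{u, v} {k : Type u} {R : Type v} [Field k] [CommRing R] [Algebra k R]
    (p₁ p₂ : Ideal R) [p₁.IsPrime] [p₂.IsPrime] :
    ∃ (K : Type v) (_ : Field K) (_ : Algebra k K) (f₁ f₂ : R →ₐ[k] K),
      RingHom.ker f₁ = p₁ ∧ RingHom.ker f₂ = p₂ := by
  obtain ⟨M, hM⟩ := Ideal.exists_maximal (p₁.ResidueField ⊗[k] p₂.ResidueField)
  let := Ideal.Quotient.field M
  let g₁ : p₁.ResidueField →ₐ[k] _ ⧸ M :=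
    (Ideal.Quotient.mkₐ k M).comp Algebra.TensorProduct.includeLeft
  let g₂ : p₂.ResidueField →ₐ[k] _ ⧸ M :=
    (Ideal.Quotient.mkₐ k M).comp Algebra.TensorProduct.includeRight
  refine ⟨_, inferInstance, inferInstance, g₁.comp (IsScalarTower.toAlgHom k R p₁.ResidueField),
    g₂.comp (IsScalarTower.toAlgHom k R p₂.ResidueField), ?_, ?_⟩
  · ext x
    simp [RingHom.mem_ker]
  · ext x
    simp [RingHom.mem_ker]

/-- With `f₁`, `f₂` the generic points of the two loci over a common field, `J` is the kernel of
evaluation at the generic point `X 0 * f₁ + X 1 * f₂` of the line through them. Specialising the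
parameters to `(1, 0)` and `(0, 1)` shows that `J` lies in both primes. -/
theorem exists_prime_le_of_minorsIdeal_le {k : Type*} [Field k] {σ m n : Type*} [Fintype m]
    [Fintype n] {φ : Matrix m n (MvPolynomial σ k)} (hlin : ∀ i j, (φ i j).IsHomogeneous 1)
    {p₁ p₂ : Ideal (MvPolynomial σ k)} [p₁.IsPrime] [p₂.IsPrime] {r₁ r₂ : ℕ}
    (h₁ : minorsIdeal (r₁ + 1) φ ≤ p₁) (h₂ : minorsIdeal (r₂ + 1) φ ≤ p₂) :
    ∃ J : Ideal (MvPolynomial σ k), J.IsPrime ∧ J ≤ p₁ ∧ J ≤ p₂ ∧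
      minorsIdeal (r₁ + r₂ + 1) φ ≤ J := by
  obtain ⟨K, _, _, f₁, f₂, rfl, rfl⟩ := exists_common_field (k := k) p₁ p₂
  let g : MvPolynomial σ k →ₐ[k] MvPolynomial (Fin 2) K :=
    aeval fun i => X 0 * C (f₁ (X i)) + X 1 * C (f₂ (X i))
  have hg : ∀ ℓ : MvPolynomial σ k, ℓ.IsHomogeneous 1 →
      g ℓ = X 0 * C (f₁ ℓ) + X 1 * C (f₂ ℓ) := fun ℓ hℓ => by
    rw [← mem_homogeneousSubmodule, homogeneousSubmodule_one_eq_span_X] at hℓ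
    induction hℓ using Submodule.span_induction with
    | mem x hx => obtain ⟨i, rfl⟩ := hx; simp [g]
    | zero => simp
    | add x y _ _ hx hy => simp only [map_add, hx, hy]; ring
    | smul a x _ hx =>
      have hC (b : K) : C (a • b) = a • (C b : MvPolynomial (Fin 2) K) :=
        (smul_monomial (s := 0) (a := b) a).symm
      rw [map_smul, map_smul f₁, map_smul f₂, hx, hC, hC, smul_add, mul_smul_comm, mul_smul_comm]
  have e₁ : ((aeval ![(1 : K), 0]).restrictScalars k).comp g = f₁ := by
    ext i; simp [g]
  have e₂ : ((aeval ![(0 : K), 1]).restrictScalars k).comp g = f₂ := by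
    ext i; simp [g]
  refine ⟨RingHom.ker g, RingHom.ker_isPrime g, fun x hx => ?_, fun x hx => ?_, ?_⟩
  · rw [RingHom.mem_ker] at hx ⊢
    rw [← e₁, AlgHom.comp_apply, hx, map_zero]
  · rw [RingHom.mem_ker] at hx ⊢
    rw [← e₂, AlgHom.comp_apply, hx, map_zero]
  -- The rank bound needs a field, so the parameters `X 0`, `X 1` are viewed in the fraction field.
  let L := FractionRing (MvPolynomial (Fin 2) K)
  let ι : MvPolynomial (Fin 2) K →+* L := algebraMap _ L
  have hι : Function.Injective ι := IsFractionRing.injective _ _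
  let F (f : MvPolynomial σ k →ₐ[k] K) : MvPolynomial σ k →+* L := (ι.comp C).comp f
  have hF (f : MvPolynomial σ k →ₐ[k] K) : RingHom.ker f ≤ RingHom.ker (F f) := fun x hx => by
    rw [RingHom.mem_ker] at hx ⊢
    simp [F, hx]
  have key : φ.map (ι.comp (g : MvPolynomial σ k →+* MvPolynomial (Fin 2) K)) =
      ι (X 0) • φ.map (F f₁) + ι (X 1) • φ.map (F f₂) := by
    ext i j
    change ι (g (φ i j)) = ι (X 0) * ι (C (f₁ (φ i j))) + ι (X 1) * ι (C (f₂ (φ i j)))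
    rw [hg _ (hlin i j), ι.map_add, ι.map_mul, ι.map_mul]
  have hr : (φ.map (ι.comp (g : MvPolynomial σ k →+* MvPolynomial (Fin 2) K))).rank ≤
      r₁ + r₂ := by
    rw [key]
    refine (rank_add_le _ _).trans (add_le_add ?_ ?_)
    · exact (rank_smul_le _ _).trans
        (rank_le_of_minorsIdeal_eq_bot (minorsIdeal_map_eq_bot _ (h₁.trans (hF f₁))))
    · exact (rank_smul_le _ _).trans
        (rank_le_of_minorsIdeal_eq_bot (minorsIdeal_map_eq_bot _ (h₂.trans (hF f₂))))
  have hb := minorsIdeal_eq_bot_of_rank_le hr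
  rw [minorsIdeal, Ideal.span_eq_bot] at hb
  refine Ideal.span_le.2 ?_
  rintro _ ⟨r, c, rfl⟩
  have := hb _ ⟨r, c, rfl⟩
  rw [submatrix_map, ← RingHom.mapMatrix_apply, ← RingHom.map_det, RingHom.comp_apply,
    map_eq_zero_iff _ hι] at this
  exact this

end Join

/-! ### Maximal minors and the Hilbert–Burch complex -/

section MaximalMinors

variable {R : Type*} [CommRing R] {m : ℕ}

/-- The signed maximal minors of an `(m + 1) × m` matrix: the `i`-th one deletes row `i`. -/
def signedMinor (A : Matrix (Fin (m + 1)) (Fin m) R) (i : Fin (m + 1)) : R :=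
  (-1) ^ (i : ℕ) * (A.submatrix i.succAbove id).det

/-- The square matrix obtained from `A` by prepending the column `v`. -/
def prependCol (v : Fin (m + 1) → R) (A : Matrix (Fin (m + 1)) (Fin m) R) :
    Matrix (Fin (m + 1)) (Fin (m + 1)) R :=
  Matrix.of fun i => Fin.cons (v i) (A i)

theorem det_prependCol (v : Fin (m + 1) → R) (A : Matrix (Fin (m + 1)) (Fin m) R) :
    (prependCol v A).det = signedMinor A ⬝ᵥ v := by
  rw [det_succ_column_zero]
  refine Finset.sum_congr rfl fun i _ => ?_
  rw [signedMinor, mul_right_comm]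
  rfl

theorem signedMinor_vecMul (A : Matrix (Fin (m + 1)) (Fin m) R) : signedMinor A ᵥ* A = 0 := by
  ext j
  have := det_prependCol (fun i => A i j) A
  rw [det_zero_of_column_eq (Fin.succ_ne_zero j).symm (fun i => by simp [prependCol])] at this
  exact this.symm

theorem minorsIdeal_eq_span_signedMinor (A : Matrix (Fin (m + 1)) (Fin m) R) :
    minorsIdeal m A = Ideal.span (Set.range (signedMinor A)) := by
  refine le_antisymm (Ideal.span_le.2 ?_) (Ideal.span_le.2 ?_)
  · rintro _ ⟨r, c, rfl⟩
    obtain ⟨i, hi⟩ : ∃ i, ∀ j, r j ≠ i := by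
      by_contra! h
      have := Fintype.card_le_of_surjective r h
      simp at this
    choose s hs using fun j => Fin.exists_succAbove_eq (hi j)
    have hs' : Function.Injective s := fun a b h => r.injective (by rw [← hs, ← hs, h])
    let σ : Equiv.Perm (Fin m) := Equiv.ofBijective s (Finite.injective_iff_bijective.1 hs')
    let τ : Equiv.Perm (Fin m) := Equiv.ofBijective c (Finite.injective_iff_bijective.1 c.injective)
    have hA : A.submatrix r c = ((A.submatrix i.succAbove id).submatrix id τ).submatrix σ id := by
      ext a b
      simp [σ, τ, hs]
    have hd : (A.submatrix i.succAbove id).det = (-1) ^ (i : ℕ) * signedMinor A i := by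
      rw [signedMinor, ← mul_assoc, ← pow_add, ← two_mul, pow_mul]
      simp
    rw [hA, det_permute, det_permute', hd]
    exact Ideal.mul_mem_left _ _ (Ideal.mul_mem_left _ _ (Ideal.mul_mem_left _ _
      (Ideal.subset_span ⟨i, rfl⟩)))
  · rintro _ ⟨i, rfl⟩
    exact Ideal.mul_mem_left _ _
      (Ideal.subset_span ⟨Fin.succAboveEmb i, Function.Embedding.refl _, rfl⟩)

/-- Prepending `v` to `A` gives a square matrix of determinant zero, so it kills each column of its
adjugate. Column `i` has top entry `signedMinor A i`; the other entries, negated, form `w`. -/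
theorem exists_mulVec_eq_signedMinor_smul (A : Matrix (Fin (m + 1)) (Fin m) R)
    {v : Fin (m + 1) → R} (hv : signedMinor A ⬝ᵥ v = 0) (i : Fin (m + 1)) :
    ∃ w, A *ᵥ w = signedMinor A i • v := by
  have h : prependCol v A * (prependCol v A).adjugate = 0 := by
    rw [mul_adjugate, det_prependCol, hv, zero_smul]
  refine ⟨fun j => -(prependCol v A).adjugate j.succ i, ?_⟩
  ext a
  have ha := congr_fun (congr_fun h a) i
  rw [mul_apply, Fin.sum_univ_succ, adjugate_fin_succ_eq_det_submatrix] at ha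
  have h0 : (prependCol v A).submatrix i.succAbove (Fin.succAbove 0) =
      A.submatrix i.succAbove id := by
    ext x y
    simp [prependCol]
  rw [h0] at ha
  simp only [prependCol, of_apply, Fin.cons_zero, Fin.cons_succ, Fin.val_zero, add_zero,
    Matrix.zero_apply] at ha
  simp only [mulVec, dotProduct, Pi.smul_apply, smul_eq_mul, mul_neg, Finset.sum_neg_distrib,
    signedMinor, prependCol]
  linear_combination -ha

theorem eq_zero_of_mulVec_eq_zero_of_signedMinor [IsDomain R] {A : Matrix (Fin (m + 1)) (Fin m) R}
    {i : Fin (m + 1)} (hi : signedMinor A i ≠ 0) {w : Fin m → R} (hw : A *ᵥ w = 0) : w = 0 := by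
  refine eq_zero_of_mulVec_eq_zero (right_ne_zero_of_mul hi)
    (?_ : A.submatrix i.succAbove id *ᵥ w = 0)
  ext j
  exact congr_fun hw (i.succAbove j)

/-- The exactness part of the Hilbert–Burch theorem over a unique factorization domain. -/
theorem exists_mulVec_eq_of_signedMinor_dotProduct_eq_zero [IsDomain R]
    [UniqueFactorizationMonoid R] {A : Matrix (Fin (m + 1)) (Fin m) R}
    (hA : ∀ d, (∀ i, d ∣ signedMinor A i) → IsUnit d)
    {v : Fin (m + 1) → R} (hv : signedMinor A ⬝ᵥ v = 0) : ∃ w, A *ᵥ w = v := by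
  obtain ⟨i, hi⟩ : ∃ i, signedMinor A i ≠ 0 := by
    by_contra! h
    exact not_isUnit_zero (hA 0 fun i => by rw [h i])
  choose w hw using exists_mulVec_eq_signedMinor_smul A hv
  have hcomm : ∀ j, signedMinor A j • w i = signedMinor A i • w j := fun j => by
    rw [← sub_eq_zero]
    refine eq_zero_of_mulVec_eq_zero_of_signedMinor hi ?_
    rw [mulVec_sub, mulVec_smul, mulVec_smul, hw, hw, smul_comm, sub_self]
  have hdvd : ∀ a, signedMinor A i ∣ w i a := fun a => by
    -- In lowest terms `w i a / signedMinor A i = s / t`. By `hcomm` the denominator `t` divides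
    -- every signed minor, so it is a unit.
    obtain ⟨t, s, c, hrel, ht, hs⟩ :=
      UniqueFactorizationMonoid.exists_reduced_factors _ hi (w i a)
    have hc : c ≠ 0 := fun h => hi (by rw [← ht, h, zero_mul])
    have htu : IsUnit t := hA t fun j => hrel.dvd_of_dvd_mul_right (by
      refine ⟨w j a, mul_left_cancel₀ hc ?_⟩
      have := congr_fun (hcomm j) a
      simp only [Pi.smul_apply, smul_eq_mul] at this
      linear_combination this + signedMinor A j * hs - w j a * ht)
    obtain ⟨e, he⟩ := htu.dvd (a := s)
    exact ⟨e, by rw [← hs, ← ht, he]; ring⟩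
  choose e he using hdvd
  refine ⟨e, ?_⟩
  have h1 : w i = signedMinor A i • e := by ext a; exact he a
  have h2 := hw i
  rw [h1, mulVec_smul] at h2
  exact smul_right_injective _ hi h2

/-- An ideal with a free resolution of length two contains every element that three elements of
a regular sequence multiply into it. -/
theorem mem_span_range_of_mul_mem [IsDomain R] {ι κ : Type*} [Fintype ι] [Fintype κ]
    {A : Matrix ι κ R} {d : ι → R} (hcomp : d ᵥ* A = 0) (hinj : ∀ w, A *ᵥ w = 0 → w = 0)
    (hexact : ∀ v, d ⬝ᵥ v = 0 → ∃ w, A *ᵥ w = v) {a b c : R} (ha : a ≠ 0)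
    (hab : ∀ s, b * s ∈ Ideal.span {a} → s ∈ Ideal.span {a})
    (habc : ∀ s, c * s ∈ Ideal.span {a, b} → s ∈ Ideal.span {a, b}) {f : R}
    (hfa : a * f ∈ Ideal.span (Set.range d)) (hfb : b * f ∈ Ideal.span (Set.range d))
    (hfc : c * f ∈ Ideal.span (Set.range d)) : f ∈ Ideal.span (Set.range d) := by
  have span_iff : ∀ g, g ∈ Ideal.span (Set.range d) ↔ ∃ v, d ⬝ᵥ v = g := fun g => by
    rw [Ideal.mem_span_range_iff_exists_fun]
    simp only [dotProduct, mul_comm]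
  rw [span_iff] at hfa hfb hfc
  obtain ⟨α, hα⟩ := hfa
  obtain ⟨β, hβ⟩ := hfb
  obtain ⟨γ, hγ⟩ := hfc
  -- Diagram chase against the Koszul complex of `a, b, c`: the syzygies lift to `x, y, z`, and
  -- injectivity transports the Koszul relation to them.
  obtain ⟨x, hx⟩ := hexact (b • α - a • β) (by
    rw [dotProduct_sub, dotProduct_smul, dotProduct_smul, hα, hβ, smul_eq_mul, smul_eq_mul]; ring)
  obtain ⟨y, hy⟩ := hexact (c • α - a • γ) (by
    rw [dotProduct_sub, dotProduct_smul, dotProduct_smul, hα, hγ, smul_eq_mul, smul_eq_mul]; ring)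
  obtain ⟨z, hz⟩ := hexact (c • β - b • γ) (by
    rw [dotProduct_sub, dotProduct_smul, dotProduct_smul, hβ, hγ, smul_eq_mul, smul_eq_mul]; ring)
  have hxyz : c • x - b • y + a • z = 0 := hinj _ (by
    rw [mulVec_add, mulVec_sub, mulVec_smul, mulVec_smul, mulVec_smul, hx, hy, hz]
    ext i
    simp only [Pi.add_apply, Pi.sub_apply, Pi.smul_apply, smul_eq_mul, Pi.zero_apply]
    ring)
  have hx' : ∀ j, ∃ μ ν, μ * a + ν * b = x j := fun j => by
    rw [← Ideal.mem_span_pair]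
    refine habc _ (Ideal.mem_span_pair.2 ⟨-z j, y j, ?_⟩)
    have := congr_fun hxyz j
    simp only [Pi.add_apply, Pi.sub_apply, Pi.smul_apply, smul_eq_mul, Pi.zero_apply] at this
    linear_combination -this
  choose μ ν hμν using hx'
  have hx'' : x = a • μ + b • ν := by
    ext j
    simp [← hμν j, mul_comm]
  -- Since `x = a μ + b ν`, the equation for `x` reads `b (α - A ν) = a (β + A μ)`. Correcting `α`
  -- by the syzygy `A ν` thus makes it divisible by `a`.
  have hdiv : ∀ i, ∃ δ, δ * a = (α - A *ᵥ ν) i := fun i => by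
    rw [← Ideal.mem_span_singleton']
    refine hab _ (Ideal.mem_span_singleton'.2 ⟨(β + A *ᵥ μ) i, ?_⟩)
    have := congr_fun hx i
    rw [hx'', mulVec_add, mulVec_smul, mulVec_smul] at this
    simp only [Pi.add_apply, Pi.sub_apply, Pi.smul_apply, smul_eq_mul] at this ⊢
    linear_combination this
  choose δ hδ using hdiv
  have hδ' : α = a • δ + A *ᵥ ν := by
    ext i
    simp only [Pi.add_apply, Pi.smul_apply, smul_eq_mul]
    have := hδ i
    simp only [Pi.sub_apply] at this
    linear_combination -this
  refine (span_iff f).2 ⟨δ, mul_left_cancel₀ ha ?_⟩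
  rw [← hα, hδ', dotProduct_add, dotProduct_mulVec, hcomp, zero_dotProduct, add_zero,
    dotProduct_smul, smul_eq_mul]

/-- A relation matrix with an invertible `t × t` minor makes `t` of the generators redundant. -/
theorem spanFinrank_span_range_le {n : ℕ} {κ : Type*} {A : Matrix (Fin n) κ R}
    {d : Fin n → R} (hcomp : d ᵥ* A = 0) {t : ℕ} (r : Fin t ↪ Fin n) (c : Fin t → κ)
    (hdet : IsUnit (A.submatrix r c).det) :
    (Ideal.span (Set.range d)).spanFinrank ≤ n - t := by
  classical
  let T : Finset (Fin n) := (Finset.univ.map r)ᶜ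
  have hT : T.card = n - t := by simp [T, Finset.card_compl]
  have hmem : ∀ j, ((d ∘ r) ᵥ* A.submatrix r c) j ∈ Ideal.span (d '' T) := fun j => by
    have h0 := congr_fun hcomp (c j)
    simp only [vecMul, dotProduct, Pi.zero_apply] at h0
    rw [← Finset.sum_add_sum_compl (Finset.univ.map r), Finset.sum_map] at h0
    have : ((d ∘ r) ᵥ* A.submatrix r c) j = -∑ i ∈ T, d i * A i (c j) :=
      eq_neg_of_add_eq_zero_left h0
    rw [this]
    exact neg_mem (Ideal.sum_mem _ fun i hi =>
      Ideal.mul_mem_right _ _ (Ideal.subset_span ⟨i, hi, rfl⟩))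
  have hr : ∀ j, d (r j) ∈ Ideal.span (d '' T) := fun j => by
    have : d ∘ r = ((d ∘ r) ᵥ* A.submatrix r c) ᵥ* (A.submatrix r c)⁻¹ := by
      rw [vecMul_vecMul, mul_nonsing_inv _ hdet, vecMul_one]
    rw [← Function.comp_apply (f := d), this]
    change ∑ i, ((d ∘ r) ᵥ* A.submatrix r c) i * (A.submatrix r c)⁻¹ i j ∈ _
    exact Ideal.sum_mem _ fun i _ => Ideal.mul_mem_right _ _ (hmem i)
  have hspan : Ideal.span (Set.range d) = Ideal.span (d '' T) := by
    refine le_antisymm (Ideal.span_le.2 ?_) (Ideal.span_mono (Set.image_subset_range _ _))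
    rintro _ ⟨i, rfl⟩
    by_cases hi : i ∈ T
    · exact Ideal.subset_span ⟨i, hi, rfl⟩
    · obtain ⟨j, rfl⟩ : ∃ j, r j = i := by simpa [T] using hi
      exact hr j
  rw [hspan]
  refine (Submodule.spanFinrank_span_le_ncard_of_finite (T.finite_toSet.image d)).trans ?_
  rw [← hT, ← Set.ncard_coe_finset]
  exact Set.ncard_image_le T.finite_toSet

end MaximalMinors

/-! ### Regular sequences of one-variable polynomials -/

section RegularSequence

/-- A monic polynomial stays monic, hence a nonzerodivisor, over `A ⧸ J`. -/
theorem mem_map_C_of_monic_mul_mem {A : Type*} [CommRing A] {J : Ideal A} {c e : Polynomial A}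
    (hc : c.Monic) (h : c * e ∈ J.map Polynomial.C) : e ∈ J.map Polynomial.C := by
  rw [← Ideal.mk_ker (I := J), ← Polynomial.ker_mapRingHom, RingHom.mem_ker,
    Polynomial.coe_mapRingHom] at h ⊢
  rw [Polynomial.map_mul] at h
  exact (hc.map _).mul_right_eq_zero_iff.1 h

theorem mem_map_C_of_C_mul_mem {A : Type*} [CommRing A] {J : Ideal A} {b : A}
    (hb : ∀ s, b * s ∈ J → s ∈ J) {e : Polynomial A}
    (h : Polynomial.C b * e ∈ J.map Polynomial.C) : e ∈ J.map Polynomial.C := by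
  rw [Ideal.mem_map_C_iff] at h ⊢
  exact fun n => hb _ (by simpa using h n)

open MvPolynomial

variable {k : Type*} [Field k]

theorem finSuccEquiv_aeval_X_zero {n : ℕ} (g : Polynomial k) :
    finSuccEquiv k n (Polynomial.aeval (X 0) g) = g.map C := by
  rw [← Polynomial.aeval_algHom_apply, finSuccEquiv_X_zero, ← Polynomial.aeval_map_algebraMap
    (MvPolynomial (Fin n) k), Polynomial.aeval_X_left_apply, algebraMap_eq]

theorem finSuccEquiv_aeval_X_succ {n : ℕ} (i : Fin n) (g : Polynomial k) :
    finSuccEquiv k n (Polynomial.aeval (X i.succ) g) =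
      Polynomial.C (Polynomial.aeval (X i) g) := by
  rw [← Polynomial.aeval_algHom_apply, finSuccEquiv_X_succ]
  exact (Polynomial.aeval_algebraMap_apply (Polynomial (MvPolynomial (Fin n) k)) (X i) g)

theorem mem_span_iff_finSuccEquiv {n : ℕ} {f : MvPolynomial (Fin (n + 1)) k}
    {s : Set (MvPolynomial (Fin (n + 1)) k)} {t : Set (MvPolynomial (Fin n) k)}
    (h : finSuccEquiv k n '' s = Polynomial.C '' t) :
    f ∈ Ideal.span s ↔ finSuccEquiv k n f ∈ (Ideal.span t).map Polynomial.C := by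
  rw [Ideal.map_span, ← h, ← Ideal.map_span]
  rw [Ideal.mem_map_of_equiv]
  exact ⟨fun hf => ⟨f, hf, rfl⟩, fun ⟨g, hg, hgf⟩ => (finSuccEquiv k n).injective hgf ▸ hg⟩

theorem mem_span_aeval_X_one_of_mul_mem {g₀ g₁ : Polynomial k} (h₀ : g₀.Monic)
    {s : MvPolynomial (Fin 2) k}
    (h : Polynomial.aeval (X 0) g₀ * s ∈ Ideal.span {Polynomial.aeval (X 1) g₁}) :
    s ∈ Ideal.span {Polynomial.aeval (X 1 : MvPolynomial (Fin 2) k) g₁} := by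
  rw [mem_span_iff_finSuccEquiv (t := {Polynomial.aeval (X 0) g₁})
    (by simpa using finSuccEquiv_aeval_X_succ (0 : Fin 1) g₁)] at h ⊢
  rw [map_mul, finSuccEquiv_aeval_X_zero] at h
  exact mem_map_C_of_monic_mul_mem (h₀.map _) h

/-- Over the polynomial ring in the other variables, `g₀` is monic in the separated variable `X 0`,
while the ideal is extended from the coefficients. -/
theorem mem_span_aeval_X_pair_of_mul_mem {g₀ g₁ g₂ : Polynomial k} (h₀ : g₀.Monic)
    {s : MvPolynomial (Fin 3) k}
    (h : Polynomial.aeval (X 0) g₀ * s ∈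
      Ideal.span {Polynomial.aeval (X 2) g₂, Polynomial.aeval (X 1) g₁}) :
    s ∈ Ideal.span
      {Polynomial.aeval (X 2 : MvPolynomial (Fin 3) k) g₂, Polynomial.aeval (X 1) g₁} := by
  rw [mem_span_iff_finSuccEquiv
    (t := {Polynomial.aeval (X 1) g₂, Polynomial.aeval (X 0) g₁}) (by
      rw [Set.image_pair, Set.image_pair]
      exact congrArg₂ _ (finSuccEquiv_aeval_X_succ (1 : Fin 2) g₂)
        (congrArg _ (finSuccEquiv_aeval_X_succ (0 : Fin 2) g₁)))] at h ⊢
  rw [map_mul, finSuccEquiv_aeval_X_zero] at h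
  exact mem_map_C_of_monic_mul_mem (h₀.map _) h

theorem mem_span_aeval_X_two_of_mul_mem {g₁ g₂ : Polynomial k} (h₁ : g₁.Monic)
    {s : MvPolynomial (Fin 3) k}
    (h : Polynomial.aeval (X 1) g₁ * s ∈ Ideal.span {Polynomial.aeval (X 2) g₂}) :
    s ∈ Ideal.span {Polynomial.aeval (X 2 : MvPolynomial (Fin 3) k) g₂} := by
  rw [mem_span_iff_finSuccEquiv (t := {Polynomial.aeval (X 1) g₂})
    (by simpa using finSuccEquiv_aeval_X_succ (1 : Fin 2) g₂)] at h ⊢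
  rw [map_mul, show (X 1 : MvPolynomial (Fin 3) k) = X (Fin.succ 0) from rfl,
    finSuccEquiv_aeval_X_succ] at h
  exact mem_map_C_of_C_mul_mem (fun _ => mem_span_aeval_X_one_of_mul_mem h₁) h

/-- By the Nullstellensatz the residue field is finite over `k`, so the image of `X i` is integral.
-/
theorem exists_monic_aeval_X_mem {σ : Type*} [Finite σ] (p : Ideal (MvPolynomial σ k))
    [p.IsMaximal] (i : σ) : ∃ g : Polynomial k, g.Monic ∧ Polynomial.aeval (X i) g ∈ p := by
  let := Ideal.Quotient.field p
  have := finite_of_finite_type_of_isJacobsonRing k (MvPolynomial σ k ⧸ p)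
  obtain ⟨g, hg, hg'⟩ := Algebra.IsIntegral.isIntegral (R := k) (Ideal.Quotient.mkₐ k p (X i))
  refine ⟨g, hg, ?_⟩
  rw [← Ideal.Quotient.eq_zero_iff_mem, ← Ideal.Quotient.mkₐ_eq_mk k,
    ← Polynomial.aeval_algHom_apply]
  exact hg'

end RegularSequence

/-! ### Unmixedness of the ideal of maximal minors -/

section Unmixed

theorem isUnit_of_two_le_height {R : Type*} [CommRing R] [IsNoetherianRing R] {I : Ideal R}
    (hI : 2 ≤ I.height) {d : R} (hd : I ≤ Ideal.span {d}) : IsUnit d := by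
  by_contra h
  obtain ⟨p, hp⟩ := Ideal.nonempty_minimalPrimes (mt Ideal.span_singleton_eq_top.1 h)
  have h1 := Ideal.height_le_one_of_isPrincipal_of_mem_minimalPrimes _ p hp
  have := (hI.trans (Ideal.height_mono (hd.trans hp.1.2))).trans h1
  exact absurd this (by decide)

variable {k : Type*} [Field k]

theorem isMaximal_of_three_le_height {p : Ideal (MvPolynomial (Fin 3) k)} [p.IsPrime]
    (hp : 3 ≤ p.height) : p.IsMaximal := by
  have hdim : ringKrullDim (MvPolynomial (Fin 3) k) = 3 := by
    simp [MvPolynomial.ringKrullDim_of_isNoetherianRing]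
  have : FiniteRingKrullDim (MvPolynomial (Fin 3) k) := by
    rw [finiteRingKrullDim_iff_ne_bot_and_top, hdim]
    exact ⟨by decide, by decide⟩
  refine Ideal.isMaximal_of_height_eq_ringKrullDim (le_antisymm
    Ideal.height_le_ringKrullDim_of_isPrime ?_)
  rw [hdim]
  exact WithBot.coe_le_coe.2 hp

/-- A nonminimal associated prime `p = (I : f)` would have height at least 3, hence be maximal and
contain a regular sequence `g₂(X 2), g₁(X 1), g₀(X 0)`. These multiply `f` into `I`, so `f ∈ I` by
the Hilbert–Burch resolution, giving `1 ∈ p`. -/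
theorem mem_minimalPrimes_of_mem_associatedPrimes {m : ℕ}
    {A : Matrix (Fin (m + 1)) (Fin m) (MvPolynomial (Fin 3) k)}
    (hA : 2 ≤ (minorsIdeal m A).height) {p : Ideal (MvPolynomial (Fin 3) k)}
    (hp : p ∈ associatedPrimes _ (MvPolynomial (Fin 3) k ⧸ minorsIdeal m A)) :
    p ∈ (minorsIdeal m A).minimalPrimes := by
  obtain ⟨_, x, hx⟩ := isAssociatedPrime_iff.1 hp
  obtain ⟨f, rfl⟩ := Ideal.Quotient.mk_surjective x
  have hmem : ∀ {g}, g ∈ p ↔ g * f ∈ minorsIdeal m A := fun {g} => by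
    rw [hx, Submodule.mem_colon_singleton, Submodule.mem_bot, Algebra.smul_def,
      Ideal.Quotient.algebraMap_eq, ← map_mul, Ideal.Quotient.eq_zero_iff_mem]
  have hle : minorsIdeal m A ≤ p := fun g hg => hmem.2 (Ideal.mul_mem_right _ _ hg)
  by_contra hmin
  obtain ⟨p', hp', hle'⟩ := Ideal.exists_minimalPrimes_le hle
  have := hp'.1.1
  have hlt : p' < p := lt_of_le_of_ne hle' (by rintro rfl; exact hmin hp')
  have hmax : p.IsMaximal := isMaximal_of_three_le_height (by
    have h1 := Ideal.height_add_one_le_of_lt_of_isPrime hlt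
    have h2 := hA.trans (Ideal.height_mono hp'.1.2)
    exact le_trans (by gcongr : (2 : ℕ∞) + 1 ≤ p'.height + 1) h1)
  choose g hg hgp using exists_monic_aeval_X_mem p
  refine hmax.ne_top ((Ideal.eq_top_iff_one _).2 (hmem.2 ?_))
  rw [minorsIdeal_eq_span_signedMinor] at hmem hA ⊢
  have hgcd : ∀ d, (∀ i, d ∣ signedMinor A i) → IsUnit d := fun d hd =>
    isUnit_of_two_le_height hA (Ideal.span_le.2 (by
      rintro _ ⟨i, rfl⟩
      exact Ideal.mem_span_singleton.2 (hd i)))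
  obtain ⟨i, hi⟩ : ∃ i, signedMinor A i ≠ 0 := by
    by_contra! h
    exact not_isUnit_zero (hgcd 0 fun i => by rw [h i])
  rw [one_mul]
  refine mem_span_range_of_mul_mem (signedMinor_vecMul A)
    (fun w => eq_zero_of_mulVec_eq_zero_of_signedMinor hi)
    (fun v => exists_mulVec_eq_of_signedMinor_dotProduct_eq_zero hgcd)
    ?_ (fun s => mem_span_aeval_X_two_of_mul_mem (hg 1)) (fun s => mem_span_aeval_X_pair_of_mul_mem (hg 0))
    (hmem.1 (hgp 2)) (hmem.1 (hgp 1)) (hmem.1 (hgp 0))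
  exact fun h0 => (hg 2).ne_zero
    (transcendental_iff.1 (MvPolynomial.transcendental_X k (2 : Fin 3)) _ h0)

end Unmixed

/-! ### Minimal primes, local chaos invariants and local generators -/

section Main

open MvPolynomial

variable {k : Type*} [Field k]

theorem isChaosInvariant_chaosInvariant {R : Type*} [CommRing R] {n : ℕ}
    {A : Matrix (Fin n) (Fin (n - 1)) R} (h1 : (minorsIdeal 1 A).height = 3)
    (h2 : (minorsIdeal (n - 1) A).height = 2) : IsChaosInvariant A (chaosInvariant A) :=
  Nat.sInf_mem (existsUnique_isChaosInvariant A h1 h2).exists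

theorem IsChaosInvariantAt.chaosInvariantAt_eq {R : Type*} [CommRing R] {n : ℕ}
    {A : Matrix (Fin n) (Fin (n - 1)) R} {p : Ideal R} {v : ℕ} (hv : IsChaosInvariantAt A p v) :
    chaosInvariantAt A p = v :=
  IsChaosInvariantAt.eq (Nat.sInf_mem (s := {v | IsChaosInvariantAt A p v}) ⟨v, hv⟩) hv

theorem mem_minimalPrimes_of_le {R : Type*} [CommRing R] {I I' p : Ideal R}
    (hp : p ∈ I.minimalPrimes) (hI : I ≤ I') (hI' : I' ≤ p) : p ∈ I'.minimalPrimes :=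
  ⟨⟨hp.1.1, hI'⟩, fun _ hJ hJp => hp.2 ⟨hJ.1, hI.trans hJ.2⟩ hJp⟩

/-- A prime over `I'` of height `h` also contains `I`, and having the height of `I` it is minimal
over it. -/
theorem exists_mem_minimalPrimes_of_height_eq {R : Type*} [CommRing R] {I I' : Ideal R} {h : ℕ}
    (hI : I.height = h) (hI' : I'.height = h) (hle : I ≤ I') :
    ∃ p ∈ I.minimalPrimes, I' ≤ p := by
  obtain ⟨p, hp, hle', hph⟩ := Ideal.exists_isPrime_height_eq hI'
  have : p.FiniteHeight := ⟨Or.inr (by rw [hph]; exact ENat.natCast_ne_top h)⟩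
  exact ⟨p, Ideal.mem_minimalPrimes_of_height_le (hle.trans hle') (by rw [hph, hI]), hle'⟩

/-- A minimal prime of an ideal of minors of a linear matrix at which the matrix has small rank is
contained in every other prime at which the rank is small. -/
theorem le_of_minorsIdeal_le {σ m n : Type*} [Fintype m] [Fintype n]
    {φ : Matrix m n (MvPolynomial σ k)} (hlin : ∀ i j, (φ i j).IsHomogeneous 1)
    {p q : Ideal (MvPolynomial σ k)} [p.IsPrime] {r₁ r₂ s : ℕ} (hs : r₁ + r₂ + 1 ≤ s)
    (hq : q ∈ (minorsIdeal s φ).minimalPrimes) (h₁ : minorsIdeal (r₁ + 1) φ ≤ q)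
    (h₂ : minorsIdeal (r₂ + 1) φ ≤ p) : q ≤ p := by
  have := hq.1.1
  obtain ⟨J, hJ, hJq, hJp, hle⟩ := exists_prime_le_of_minorsIdeal_le hlin h₁ h₂
  exact (hq.2 ⟨hJ, (minorsIdeal_antitone φ hs).trans hle⟩ hJq).trans hJp

theorem exists_isChaosInvariantAt {R : Type*} [CommRing R] {n : ℕ}
    {A : Matrix (Fin n) (Fin (n - 1)) R} {p : Ideal R}
    (hp : p ∈ (minorsIdeal (n - 1) A).minimalPrimes) {t : ℕ} (ht : 1 ≤ t)
    (htp : ¬ minorsIdeal t A ≤ p) : ∃ v, t ≤ v ∧ IsChaosInvariantAt A p v := by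
  classical
  have hex : ∃ v, minorsIdeal (v + 1) A ≤ p :=
    ⟨n - 1, (minorsIdeal_succ_le _ A).trans hp.1.2⟩
  have htv : t ≤ Nat.find hex := by
    by_contra! h
    exact htp ((minorsIdeal_antitone A (Nat.succ_le_of_lt h)).trans (Nat.find_spec hex))
  have htn : t < n - 1 := by
    by_contra! h
    exact htp ((minorsIdeal_antitone A h).trans hp.1.2)
  have hvn : Nat.find hex ≤ n - 2 := Nat.find_min' hex (by
    rw [show n - 2 + 1 = n - 1 by omega]; exact hp.1.2)
  -- The invariant is the least `v` with `I_{v+1} ≤ p`, that is, the rank of `A` modulo `p`.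
  refine ⟨Nat.find hex, htv, by omega, by omega, ?_, fun h => ?_⟩
  · exact mem_minimalPrimes_of_le hp (minorsIdeal_antitone A (by omega)) (Nat.find_spec hex)
  · refine Nat.find_min hex (m := Nat.find hex - 1) (by omega) ?_
    rw [Nat.sub_add_cancel (by omega)]
    exact h.1.2

theorem spanFinrank_map_minorsIdeal_le {R : Type*} [CommRing R] {m : ℕ}
    {A : Matrix (Fin (m + 1)) (Fin m) R} (p : Ideal R) [p.IsPrime] {t : ℕ}
    (htp : ¬ minorsIdeal t A ≤ p) :
    ((minorsIdeal m A).map (algebraMap R (Localization.AtPrime p))).spanFinrank ≤ m + 1 - t := by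
  obtain ⟨r, c, hrc⟩ : ∃ (r : Fin t ↪ Fin (m + 1)) (c : Fin t ↪ Fin m),
      (A.submatrix r c).det ∉ p := by
    by_contra! h
    refine htp (Ideal.span_le.2 ?_)
    rintro _ ⟨r, c, rfl⟩
    exact h r c
  let f := algebraMap R (Localization.AtPrime p)
  rw [minorsIdeal_eq_span_signedMinor, Ideal.map_span, ← Set.range_comp]
  refine spanFinrank_span_range_le (A := A.map f) ?_ r c ?_
  · ext j
    have := congrArg f (congr_fun (signedMinor_vecMul A) j)
    rw [RingHom.map_vecMul] at this
    simpa using this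
  · rw [Matrix.submatrix_map, ← RingHom.mapMatrix_apply, ← RingHom.map_det]
    exact IsLocalization.map_units (Localization.AtPrime p)
      (⟨_, hrc⟩ : p.primeCompl)

end Main
end Chaos

theorem mainTheorem7 {k : Type*} [Field k] (n : ℕ)
    (φ : Matrix (Fin n) (Fin (n - 1)) (MvPolynomial (Fin 3) k))
    (hlin : ∀ i j, (φ i j).IsHomogeneous 1)
    (h1 : (Chaos.minorsIdeal 1 φ).height = 3)
    (h2 : (Chaos.minorsIdeal (n - 1) φ).height = 2)
    (hn : 2 * (Chaos.chaosInvariant φ + 1) ≤ n) :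
    ∃ q : Ideal (MvPolynomial (Fin 3) k),
      (∀ t : ℕ, Chaos.chaosInvariant φ + 1 ≤ t → t ≤ n - (Chaos.chaosInvariant φ + 1) →
        (Chaos.minorsIdeal t φ).minimalPrimes = {q}) ∧
      ∀ (p : Ideal (MvPolynomial (Fin 3) k)) [p.IsPrime],
        p ∈ associatedPrimes (MvPolynomial (Fin 3) k)
          (MvPolynomial (Fin 3) k ⧸ Chaos.minorsIdeal (n - 1) φ) →
        p ≠ q →
          n - (Chaos.chaosInvariant φ + 1) ≤ Chaos.chaosInvariantAt φ p ∧
          ((Chaos.minorsIdeal (n - 1) φ).map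
            (algebraMap (MvPolynomial (Fin 3) k) (Localization.AtPrime p))).spanFinrank
              ≤ Chaos.chaosInvariant φ + 1 := by
  obtain ⟨hu1, hun, -, hu2⟩ := Chaos.isChaosInvariant_chaosInvariant h1 h2
  generalize Chaos.chaosInvariant φ = u at *
  obtain ⟨m, rfl⟩ : ∃ m, n = m + 1 := ⟨n - 1, by omega⟩
  obtain ⟨q, hq, hqu⟩ := Chaos.exists_mem_minimalPrimes_of_height_eq (h := 2) h2
    (hu2 (u + 1) le_rfl (by omega)) (Chaos.minorsIdeal_antitone φ (by omega))
  -- The ranks `u` at `q` and `m - u - 1` at `p` add up to `m - 1`, so the join still contains the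
  -- ideal of maximal minors, over which `q` is minimal.
  have hle : ∀ t, t ≤ m - u → ∀ p : Ideal (MvPolynomial (Fin 3) k), p.IsPrime →
      Chaos.minorsIdeal t φ ≤ p → q ≤ p := fun t ht p _ hp =>
    Chaos.le_of_minorsIdeal_le hlin (r₁ := u) (r₂ := m - u - 1) (by omega) hq hqu
      ((Chaos.minorsIdeal_antitone φ (by omega)).trans hp)
  refine ⟨q, fun t ht ht' => ?_, fun p _ hp hpq => ?_⟩
  · have hqt := Chaos.mem_minimalPrimes_of_le hq (Chaos.minorsIdeal_antitone φ (by omega))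
      ((Chaos.minorsIdeal_antitone φ ht).trans hqu)
    refine Set.eq_singleton_iff_unique_mem.2 ⟨hqt, fun p hp => ?_⟩
    have hqp := hle t (by omega) p hp.1.1 hp.1.2
    exact le_antisymm (hp.2 hqt.1 hqp) hqp
  · have hmin := Chaos.mem_minimalPrimes_of_mem_associatedPrimes h2.ge hp
    have hnot : ¬ Chaos.minorsIdeal (m - u) φ ≤ p := fun h => by
      have hqp := hle _ le_rfl p inferInstance h
      exact hpq (le_antisymm (hmin.2 hq.1 hqp) hqp)
    obtain ⟨v, hv, hvp⟩ := Chaos.exists_isChaosInvariantAt hmin (by omega) hnot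
    refine ⟨?_, (Chaos.spanFinrank_map_minorsIdeal_le p hnot).trans (by omega)⟩
    rw [hvp.chaosInvariantAt_eq]
    omega
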